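/- Call a formal power series in $\mathbb{C}[[x,y]]$ algebraic if it is algebraic over $\mathbb{C}(x,y)$. (1) Let $P\in\mathbb{C}[x,y]$ be a polynomial with constant term $1$, and expand $\log P=\sum_{n,m\ge 0} f_{n,m}x^n y^m\in\mathbb{C}[[x,y]]$. Then the series $$\exp\Big(\sum_{n,m\ge 0}\binom{n+m}{n} f_{n,m}\,x^n y^m\Big)\in\mathbb{C}[[x,y]]$$ is algebraic. (2) Let $\mathbb{C}\langle\langle X,Y\rangle\rangle$ be the algebra of formal power series in two noncommuting variables, and let $c_{n,m}$ be the sum of all words with exactly $n$ letters $X$ and $m$ letters $Y$. Let $\tilde\delta=\sum_{n\ge 0,\,m\ge 1} f_{n,m}x^n y^m\in\mathbb{C}[[x,y]]$ be the logarithm of (the expansion at the origin of) a rational function in $x,y$ which is a power series with constant term $1$. Put $D=\sum_{n\ge 0,\,m\ge 1} f_{n,m}c_{n,m}$, and let $\delta$ be the continuous $\mathbb{C}$-linear derivation of $\mathbb{C}\langle\langle X,Y\rangle\rangle$ with $\delta(X)=DX-XD$ and $\delta(Y)=0$. Then the differential equation $$\frac{d}{d\tau}R(\tau)=\delta(R(\tau))+R(\tau)\,D,\qquad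 R(0)=1,\qquad \tau\in\mathbb{C},$$ (understood coefficient by coefficient) has a unique solution $R(\tau)\in\mathbb{C}\langle\langle X,Y\rangle\rangle$, and the image of $R=R(1)$ under the abelianization morphism $\mathbb{C}\langle\langle X,Y\rangle\rangle\to\mathbb{C}[[x,y]]$, $X\mapsto x$, $Y\mapsto y$, is algebraic. -/

import Mathlib

noncomputable section

namespace NCInt

/-! ### Commutative power series in two variables

`MvPowerSeries (Fin 2) ℂ` is `ℂ[[x, y]]`; index `0` stands for `x` and index `1` for `y`. -/

/-- `exp ψ = ∑ ψ ^ k / k!`, for a series `ψ` without constant term. -/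
def mvExp (ψ : MvPowerSeries (Fin 2) ℂ) : MvPowerSeries (Fin 2) ℂ :=
  (PowerSeries.exp ℂ).subst ψ

/-- `log φ = ∑ (-1) ^ (k + 1) (φ - 1) ^ k / k`, for a series `φ` with constant term `1`. -/
def mvLog (φ : MvPowerSeries (Fin 2) ℂ) : MvPowerSeries (Fin 2) ℂ :=
  (PowerSeries.log ℂ).subst (φ - 1)

/-- `∑ f_{n,m} x^n y^m ↦ ∑ binom(n+m, n) f_{n,m} x^n y^m`. -/
def binomTwist (f : MvPowerSeries (Fin 2) ℂ) : MvPowerSeries (Fin 2) ℂ :=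
  fun d => ((d 0 + d 1).choose (d 0) : ℂ) * MvPowerSeries.coeff d f

/-- A series in `ℂ[[x, y]]` is algebraic if it is a root of a nonzero one-variable polynomial with
coefficients in `ℂ[x, y]` (equivalently, after clearing denominators, in `ℂ(x, y)`). -/
def IsAlgebraicSeries (s : MvPowerSeries (Fin 2) ℂ) : Prop :=
  IsAlgebraic (MvPolynomial (Fin 2) ℂ) s

/-- A series in `ℂ[[x, y]]` that is the expansion of a rational function `P / Q`. -/
def IsRationalSeries (φ : MvPowerSeries (Fin 2) ℂ) : Prop :=
  ∃ P Q : MvPolynomial (Fin 2) ℂ, Q ≠ 0 ∧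
    (Q : MvPowerSeries (Fin 2) ℂ) * φ = (P : MvPowerSeries (Fin 2) ℂ)

/-! ### Noncommutative power series in two variables -/

/-- `ℂ⟨⟨X, Y⟩⟩`: a series is the family of its coefficients, indexed by words in the letters
`X = 0` and `Y = 1`. -/
def NCSeries : Type := List (Fin 2) → ℂ

namespace NCSeries

instance : AddCommGroup NCSeries := inferInstanceAs (AddCommGroup (List (Fin 2) → ℂ))

instance : Module ℂ NCSeries := inferInstanceAs (Module ℂ (List (Fin 2) → ℂ))

@[ext] theorem ext {f g : NCSeries} (h : ∀ w : List (Fin 2), f w = g w) : f = g := funext h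

@[simp] theorem add_apply (f g : NCSeries) (w : List (Fin 2)) : (f + g) w = f w + g w := rfl

@[simp] theorem zero_apply (w : List (Fin 2)) : (0 : NCSeries) w = 0 := rfl

@[simp] theorem sub_apply (f g : NCSeries) (w : List (Fin 2)) : (f - g) w = f w - g w := rfl

@[simp] theorem smul_apply (c : ℂ) (f : NCSeries) (w : List (Fin 2)) : (c • f) w = c * f w := rfl

/-- The series consisting of the single word `v`. -/
def word (v : List (Fin 2)) : NCSeries := fun w => if w = v then 1 else 0

instance : One NCSeries := ⟨word []⟩

/-- Concatenation product: `(f g)(w) = ∑_{w = a b} f(a) g(b)`. -/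
instance : Mul NCSeries :=
  ⟨fun f g w => ∑ i ∈ Finset.range (w.length + 1), f (w.take i) * g (w.drop i)⟩

theorem mul_apply (f g : NCSeries) (w : List (Fin 2)) :
    (f * g) w = ∑ i ∈ Finset.range (w.length + 1), f (w.take i) * g (w.drop i) := rfl

theorem one_apply (w : List (Fin 2)) : (1 : NCSeries) w = if w = [] then 1 else 0 := rfl

/-- `shift p f` has at `w` the coefficient of `f` at `p w`. -/
def shift (p : List (Fin 2)) (f : NCSeries) : NCSeries := fun w => f (p ++ w)

theorem mul_nil (f g : NCSeries) : (f * g) [] = f [] * g [] := by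
  simp [mul_apply]

theorem mul_cons (f g : NCSeries) (a : Fin 2) (w : List (Fin 2)) :
    (f * g) (a :: w) = f [] * g (a :: w) + (shift [a] f * g) w := by
  simp only [mul_apply, List.length_cons]
  rw [Finset.sum_range_succ']
  simp [shift, add_comm]

theorem shift_mul (f g : NCSeries) (a : Fin 2) :
    shift [a] (f * g) = f [] • shift [a] g + shift [a] f * g := by
  ext w
  exact mul_cons f g a w

protected theorem add_mul' (f g h : NCSeries) : (f + g) * h = f * h + g * h := by
  ext w
  simp [mul_apply, add_mul, Finset.sum_add_distrib]

protected theorem mul_add' (f g h : NCSeries) : f * (g + h) = f * g + f * h := by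
  ext w
  simp [mul_apply, mul_add, Finset.sum_add_distrib]

protected theorem smul_mul' (c : ℂ) (f g : NCSeries) : (c • f) * g = c • (f * g) := by
  ext w
  simp [mul_apply, Finset.mul_sum, mul_assoc]

protected theorem mul_assoc' (f g h : NCSeries) : f * g * h = f * (g * h) := by
  ext w
  induction w generalizing f g h with
  | nil => simp [mul_nil, mul_assoc]
  | cons a w ih =>
    rw [mul_cons, mul_cons f, shift_mul, NCSeries.add_mul', add_apply, ih, NCSeries.smul_mul',
      smul_apply, mul_cons g, mul_nil]
    ring

protected theorem zero_mul' (f : NCSeries) : 0 * f = 0 := by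
  ext w
  simp [mul_apply]

protected theorem one_mul' (f : NCSeries) : 1 * f = f := by
  ext w
  cases w with
  | nil => simp [mul_nil, one_apply]
  | cons a w =>
    have h : shift [a] (1 : NCSeries) = 0 := by
      ext v
      simp [shift, one_apply]
    rw [mul_cons, h, NCSeries.zero_mul']
    simp [one_apply]

protected theorem mul_one' (f : NCSeries) : f * 1 = f := by
  ext w
  induction w generalizing f with
  | nil => simp [mul_nil, one_apply]
  | cons a w ih =>
    rw [mul_cons, ih]
    simp [one_apply, shift]

instance : Ring NCSeries where
  __ := (inferInstance : AddCommGroup NCSeries)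
  mul := (· * ·)
  one := 1
  left_distrib := NCSeries.mul_add'
  right_distrib := NCSeries.add_mul'
  zero_mul := NCSeries.zero_mul'
  mul_zero f := by
    ext w
    simp [mul_apply]
  mul_assoc := NCSeries.mul_assoc'
  one_mul := NCSeries.one_mul'
  mul_one := NCSeries.mul_one'

/-- The variable `X`. -/
def X : NCSeries := word [0]

/-- The variable `Y`. -/
def Y : NCSeries := word [1]

/-- The continuous `ℂ`-linear derivation of `ℂ⟨⟨X, Y⟩⟩` that sends the letter `l` to `u l`: in each
word of `F`, each occurrence of a letter `l` is replaced in turn by `u l`. The coefficient at `w`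
is therefore the sum, over all letters `l` and all factorizations `w = a b c`, of
`(u l)(b) * F(a l c)`; here `a = w.take i`, and the sum over `b c = w.drop i` is a product. -/
def contDer (u : Fin 2 → NCSeries) (F : NCSeries) : NCSeries :=
  fun w => ∑ l : Fin 2, ∑ i ∈ Finset.range (w.length + 1),
    (u l * shift (w.take i ++ [l]) F) (w.drop i)

theorem contDer_nil (u : Fin 2 → NCSeries) (F : NCSeries) :
    contDer u F [] = ∑ l : Fin 2, (u l * shift [l] F) [] := by
  simp [contDer]

theorem contDer_cons (u : Fin 2 → NCSeries) (F : NCSeries) (a : Fin 2) (w : List (Fin 2)) :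
    contDer u F (a :: w)
      = ∑ l : Fin 2, (u l * shift [l] F) (a :: w) + contDer u (shift [a] F) w := by
  simp only [contDer, List.length_cons]
  rw [← Finset.sum_add_distrib]
  refine Finset.sum_congr rfl fun l _ => ?_
  rw [Finset.sum_range_succ', add_comm]
  rfl

theorem contDer_add (u : Fin 2 → NCSeries) (F G : NCSeries) :
    contDer u (F + G) = contDer u F + contDer u G := by
  ext w
  have h (p : List (Fin 2)) : shift p (F + G) = shift p F + shift p G := rfl
  simp only [contDer, h, mul_add, add_apply, Finset.sum_add_distrib]

theorem contDer_smul (u : Fin 2 → NCSeries) (c : ℂ) (F : NCSeries) :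
    contDer u (c • F) = c • contDer u F := by
  ext w
  have h (p : List (Fin 2)) (l : Fin 2) (v : List (Fin 2)) :
      (u l * shift p (c • F)) v = c * (u l * shift p F) v := by
    simp only [mul_apply, Finset.mul_sum]
    exact Finset.sum_congr rfl fun i _ => by simp only [shift, smul_apply]; ring
  simp only [contDer, h, smul_apply, Finset.mul_sum]

/-- The Leibniz rule. -/
theorem contDer_mul (u : Fin 2 → NCSeries) (F G : NCSeries) :
    contDer u (F * G) = contDer u F * G + F * contDer u G := by
  ext w
  have key (c : ℂ) (f g : NCSeries) (v : List (Fin 2)) : (f * (c • g)) v = c * (f * g) v := by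
    simp only [mul_apply, Finset.mul_sum]
    exact Finset.sum_congr rfl fun i _ => by simp only [smul_apply]; ring
  have shift_contDer (a : Fin 2) (H : NCSeries) : shift [a] (contDer u H)
      = ∑ l : Fin 2, shift [a] (u l * shift [l] H) + contDer u (shift [a] H) := by
    ext v
    simp only [Fin.sum_univ_two, add_apply]
    have := contDer_cons u H a v
    rw [Fin.sum_univ_two] at this
    exact this
  induction w generalizing F G with
  | nil =>
    simp only [add_apply, mul_nil, contDer_nil, Fin.sum_univ_two, shift_mul, smul_apply]
    ring
  | cons a w ih =>
    rw [contDer_cons, add_apply, mul_cons (contDer u F), mul_cons F, shift_contDer, contDer_cons u G,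
      shift_mul F G a, contDer_add, contDer_smul, add_apply, ih]
    simp only [Fin.sum_univ_two, shift_mul F G, mul_add, add_apply, key, ← mul_assoc, add_mul,
      smul_apply, contDer_nil, mul_cons (u _ * _) G]
    ring

/-- On the letters, `contDer u` takes the prescribed values. -/
theorem contDer_word (u : Fin 2 → NCSeries) (k : Fin 2) : contDer u (word [k]) = u k := by
  have h0 (l : Fin 2) : shift [l] (word [k]) = if l = k then 1 else 0 := by
    ext v
    by_cases h : l = k <;> simp [shift, word, h, one_apply]
  have h1 (w : List (Fin 2)) : contDer u 1 w = 0 := by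
    have hz (p : List (Fin 2)) (l : Fin 2) : shift (p ++ [l]) (1 : NCSeries) = 0 := by
      ext v
      simp [shift, one_apply]
    simp [contDer, hz]
  have h2 (w : List (Fin 2)) : contDer u 0 w = 0 := by
    have hz (p : List (Fin 2)) : shift p (0 : NCSeries) = 0 := rfl
    simp [contDer, hz]
  ext w
  cases w with
  | nil => rw [contDer_nil]; simp only [h0]; fin_cases k <;> simp
  | cons a w =>
    have h3 : contDer u (shift [a] (word [k])) w = 0 := by
      rw [h0]
      split_ifs
      · exact h1 w
      · exact h2 w
    rw [contDer_cons, h3]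
    simp only [h0]
    fin_cases k <;> simp

/-- The abelianization morphism `ℂ⟨⟨X, Y⟩⟩ → ℂ[[x, y]]`, `X ↦ x`, `Y ↦ y`: the coefficient at
`x^n y^m` is the sum of the coefficients at all words with `n` letters `X` and `m` letters `Y`. -/
def abelianize (F : NCSeries) : MvPowerSeries (Fin 2) ℂ :=
  fun d => ∑ w ∈ (Finsupp.toMultiset d).lists.toFinset, F w

end NCSeries

open NCSeries

/-! ### The Lie algebra of universal infinitesimal symmetries and its exponential -/

/-- The completed Lie algebra `∏_{n ≥ 0, m ≥ 1} ℂ δ_{n,m}`, an element `δ = ∑ f_{n,m} δ_{n,m}` being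
encoded by its generating series `∑ f_{n,m} x^n y^m`, in which no `x^n` alone occurs. -/
def gHat : Set (MvPowerSeries (Fin 2) ℂ) :=
  {f | ∀ n : ℕ, MvPowerSeries.coeff (Finsupp.single 0 n) f = 0}

/-- `D = ∑ f_{n,m} c_{n,m}`, where `c_{n,m}` is the sum of all words with `n` letters `X` and `m`
letters `Y`. -/
def symD (f : MvPowerSeries (Fin 2) ℂ) : NCSeries :=
  fun w => MvPowerSeries.coeff (Multiset.toFinsupp (w : Multiset (Fin 2))) f

/-- The derivation `δ = ∑ f_{n,m} δ_{n,m}`: it sends `X` to `[D, X]` and `Y` to `0`. -/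
def symDelta (f : MvPowerSeries (Fin 2) ℂ) : NCSeries → NCSeries :=
  contDer ![symD f * X - X * symD f, 0]

/-- `R : ℂ → ℂ⟨⟨X, Y⟩⟩` solves `dR/dτ = δ(R) + R D`, `R(0) = 1` (coefficientwise). Its solution is
the family for which `exp(τ δ)` is the automorphism `X ↦ R(τ) X R(τ)⁻¹`, `Y ↦ Y`. -/
def IsSymFlow (f : MvPowerSeries (Fin 2) ℂ) (R : ℂ → NCSeries) : Prop :=
  R 0 = 1 ∧ ∀ (τ : ℂ) (w : List (Fin 2)),
    HasDerivAt (fun s => R s w) ((symDelta f (R τ) + R τ * symD f) w) τ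

/-- `f` is the logarithm of a rational function (with value `1` at the origin). -/
def IsLogOfRational (f : MvPowerSeries (Fin 2) ℂ) : Prop :=
  ∃ φ : MvPowerSeries (Fin 2) ℂ, IsRationalSeries φ ∧ MvPowerSeries.constantCoeff φ = 1 ∧
    f = mvLog φ

end NCInt

end

/-! For part (1), put $L=\log P$ and $g=L(x(1+t)/t,\,y(1+t))$. Its coefficient at $x^ny^m$ is
$f_{n,m}t^{-n}(1+t)^{n+m}$, so the constant term of $g$ in $t$ is the twisted logarithm. Split
$g=g_-+g_+$ into strictly negative and nonnegative powers of $t$. Exponentiating factors the twisted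
$P$ as $e^{g_-}e^{g_+}$, and for some $a$ the series $t^a$ times the twisted $P$ is a polynomial $N$
in $t$ over $\mathbb{C}[x,y]$.

Then $W=t^ae^{g_-}=Ne^{-g_+}$ has powers at most $a$ on one side and only nonnegative powers on the
other, so it is a polynomial in $t$, monic of degree $a$. Similarly $U=e^{g_+}$ is a polynomial in
$t$. From $N=WU$, the roots of $W$ are roots of $N$, hence algebraic over $\mathbb{C}[x,y]$; so are
the coefficients of $W$ and those of the quotient $U$ (`isAlgebraic_coeff_of_monic_mul`). The
constant coefficient of $U$ is the required exponential. Quotients $P/Q$ follow by multiplicativity,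
once the denominator is normalised to $Q(0)=1$.

For part (2), the operator $F\mapsto\delta(F)+FD$ strictly raises word length, so the flow equation
is triangular and its solution is an exponential series, finite at each word. Abelianization kills
$\delta$, since $\delta(X)$ is a commutator, and sends $D$ to the twist of $\tilde\delta$. Hence
$R(1)$ maps to the exponential of the twist (`abelianize_symFlow_one`), which is algebraic by the
rational case of (1). -/

noncomputable section

namespace NCInt

open Finset

/-! ### Exponential and logarithm of multivariate series, through the Euler derivation. -/

section Euler

open MvPowerSeries

variable {σ R : Type*} [CommRing R]

/-- The Euler derivation `∑ xᵢ ∂/∂xᵢ`, which multiplies the coefficient at `d` by `|d|`. -/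
def euler : Derivation R (MvPowerSeries σ R) (MvPowerSeries σ R) :=
  Derivation.mk'
    { toFun := fun f d => (d.degree : R) * coeff d f
      map_add' := fun f g => by
        ext d
        exact mul_add _ _ _
      map_smul' := fun c f => by
        ext d
        exact mul_left_comm _ _ _ }
    (fun f g => by
      classical
      ext d
      change (d.degree : R) * coeff d (f * g) = coeff d (f • _ + g • _)
      rw [smul_eq_mul, smul_eq_mul, mul_comm g, map_add, coeff_mul, coeff_mul, coeff_mul, mul_sum,
        ← sum_add_distrib]
      refine sum_congr rfl fun p hp => ?_
      change _ = coeff p.1 f * ((p.2.degree : R) * coeff p.2 g) +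
        (p.1.degree : R) * coeff p.1 f * coeff p.2 g
      rw [← mem_antidiagonal.mp hp, map_add, Nat.cast_add]
      ring)

theorem coeff_euler (f : MvPowerSeries σ R) (d : σ →₀ ℕ) :
    coeff d (euler f) = (d.degree : R) * coeff d f := rfl

theorem constantCoeff_euler (f : MvPowerSeries σ R) : constantCoeff (euler f) = 0 := by
  rw [← coeff_zero_eq_constantCoeff_apply, coeff_euler]
  simp

/-- `ψ ^ k` has no terms of degree below `k`, so the substitution is a finite sum in each degree. -/
theorem coeff_subst_eq_sum_range (F : PowerSeries R) {ψ : MvPowerSeries σ R}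
    (hψ : constantCoeff ψ = 0) {d : σ →₀ ℕ} {n : ℕ} (hn : d.degree < n) :
    coeff d (F.subst ψ) = ∑ k ∈ range n, PowerSeries.coeff k F * coeff d (ψ ^ k) := by
  rw [PowerSeries.coeff_subst (PowerSeries.HasSubst.of_constantCoeff_zero hψ)]
  refine finsum_eq_sum_of_support_subset _ fun k hk => ?_
  rw [coe_range, Set.mem_Iio]
  by_contra h
  refine hk ?_
  change PowerSeries.coeff k F • coeff d (ψ ^ k) = 0
  rw [coeff_eq_zero_of_constantCoeff_nilpotent (m := 1) (by simp [hψ]) (by omega), smul_zero]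

theorem coeff_subst_mul_eq_sum_range (F : PowerSeries R) {ψ : MvPowerSeries σ R}
    (hψ : constantCoeff ψ = 0) (g : MvPowerSeries σ R) {d : σ →₀ ℕ} {n : ℕ} (hn : d.degree < n) :
    coeff d (F.subst ψ * g) = ∑ k ∈ range n, PowerSeries.coeff k F * coeff d (ψ ^ k * g) := by
  classical
  simp only [coeff_mul, mul_sum]
  rw [sum_comm]
  refine sum_congr rfl fun p hp => ?_
  have h : p.1.degree < n := by
    rw [← mem_antidiagonal.mp hp, map_add] at hn
    omega
  rw [coeff_subst_eq_sum_range F hψ h, sum_mul]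
  exact sum_congr rfl fun k _ => mul_assoc _ _ _

/-- The chain rule. -/
theorem euler_subst (F : PowerSeries R) {ψ : MvPowerSeries σ R} (hψ : constantCoeff ψ = 0) :
    euler (F.subst ψ) = (PowerSeries.derivative R F).subst ψ * euler ψ := by
  ext d
  -- The left side is truncated one term further, because differentiation lowers the index by one.
  -- Its `k = 0` term vanishes: either `d = 0` and the factor `d.degree` is zero, or `ψ ^ 0 = 1` has
  -- no coefficient at `d`.
  rw [coeff_subst_mul_eq_sum_range _ hψ _ (Nat.lt_succ_self _), coeff_euler,
    coeff_subst_eq_sum_range F hψ (n := d.degree.succ + 1) (by omega), mul_sum, sum_range_succ']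
  have h0 : (d.degree : R) * (PowerSeries.coeff 0 F * coeff d (ψ ^ 0)) = 0 := by
    classical
    rw [pow_zero, coeff_one]
    split_ifs with h
    · simp [h]
    · simp
  rw [h0, add_zero]
  refine sum_congr rfl fun k _ => ?_
  have h1 := congrArg (coeff d) (Derivation.leibniz_pow euler (a := ψ) (k + 1))
  rw [coeff_euler, Nat.add_sub_cancel, map_nsmul, smul_eq_mul, nsmul_eq_mul] at h1
  rw [mul_left_comm, h1, PowerSeries.coeff_derivative]
  push_cast
  ring

variable [Algebra ℚ R]

/-- A solution `E` of `θ E = E h`, for the Euler derivation `θ` and `h` without constant term, is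
determined by its constant term. -/
theorem eq_of_euler_eq_mul {E E' h : MvPowerSeries σ R} (hh : constantCoeff h = 0)
    (hE : euler E = E * h) (hE' : euler E' = E' * h)
    (h0 : constantCoeff E = constantCoeff E') : E = E' := by
  classical
  have hreg (n : ℕ) (hn : n ≠ 0) (r : R) (hr : (n : R) * r = 0) : r = 0 := by
    have : algebraMap ℚ R (n : ℚ)⁻¹ * ((n : R) * r) = 0 := by rw [hr, mul_zero]
    rwa [← map_natCast (algebraMap ℚ R), ← mul_assoc, ← map_mul, inv_mul_cancel₀ (by simpa),
      map_one, one_mul] at this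
  rw [← sub_eq_zero]
  have hD : euler (E - E') = (E - E') * h := by rw [map_sub, hE, hE', sub_mul]
  generalize hF : E - E' = F at hD
  have hF0 : constantCoeff F = 0 := by rw [← hF, map_sub, h0, sub_self]
  suffices H : ∀ n : ℕ, ∀ d : σ →₀ ℕ, d.degree = n → coeff d F = 0 by
    ext d
    exact H _ d rfl
  intro n
  induction n using Nat.strong_induction_on with
  | _ n ih =>
    intro d hd
    by_cases hd0 : d = 0
    · rw [hd0, coeff_zero_eq_constantCoeff_apply, hF0]
    refine hreg d.degree (by simpa [Finsupp.degree_eq_zero_iff] using hd0) _ ?_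
    -- In `|d| F_d = ∑ F_{p.1} h_{p.2}` the term `p.2 = 0` drops out since `h` has no constant term;
    -- all others involve `F` in smaller degree.
    rw [← coeff_euler, hD, coeff_mul]
    refine sum_eq_zero fun p hp => ?_
    by_cases hp2 : p.2 = 0
    · rw [hp2, coeff_zero_eq_constantCoeff_apply, hh, mul_zero]
    have hp' := congrArg Finsupp.degree (mem_antidiagonal.mp hp)
    rw [map_add] at hp'
    have : p.2.degree ≠ 0 := by simpa [Finsupp.degree_eq_zero_iff] using hp2
    rw [ih p.1.degree (by omega) p.1 rfl, zero_mul]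

theorem constantCoeff_exp_subst {ψ : MvPowerSeries σ R} (hψ : constantCoeff ψ = 0) :
    constantCoeff ((PowerSeries.exp R).subst ψ) = 1 := by
  rw [← coeff_zero_eq_constantCoeff_apply, coeff_subst_eq_sum_range _ hψ (n := 1) (by simp)]
  simp

theorem euler_exp_subst {ψ : MvPowerSeries σ R} (hψ : constantCoeff ψ = 0) :
    euler ((PowerSeries.exp R).subst ψ) = (PowerSeries.exp R).subst ψ * euler ψ := by
  rw [euler_subst _ hψ, PowerSeries.derivative_exp]

/-- The differential equation characterises the exponential. Additivity, inverses, rescaling and the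
inversion of the logarithm are all checked through it. -/
theorem exp_subst_unique {ψ E : MvPowerSeries σ R} (hψ : constantCoeff ψ = 0)
    (hE : euler E = E * euler ψ) (hE0 : constantCoeff E = 1) :
    E = (PowerSeries.exp R).subst ψ :=
  eq_of_euler_eq_mul (constantCoeff_euler ψ) hE (euler_exp_subst hψ)
    (hE0.trans (constantCoeff_exp_subst hψ).symm)

theorem exp_subst_add {ψ χ : MvPowerSeries σ R} (hψ : constantCoeff ψ = 0)
    (hχ : constantCoeff χ = 0) :
    (PowerSeries.exp R).subst (ψ + χ)
      = (PowerSeries.exp R).subst ψ * (PowerSeries.exp R).subst χ := by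
  refine (exp_subst_unique (by rw [map_add, hψ, hχ, add_zero]) ?_ ?_).symm
  · rw [Derivation.leibniz, euler_exp_subst hψ, euler_exp_subst hχ, map_add, smul_eq_mul,
      smul_eq_mul]
    ring
  · rw [map_mul, constantCoeff_exp_subst hψ, constantCoeff_exp_subst hχ, one_mul]

theorem exp_subst_mul_exp_subst_neg {ψ : MvPowerSeries σ R} (hψ : constantCoeff ψ = 0) :
    (PowerSeries.exp R).subst ψ * (PowerSeries.exp R).subst (-ψ) = 1 := by
  rw [← exp_subst_add hψ (by rw [map_neg, hψ, neg_zero]), add_neg_cancel]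
  refine (exp_subst_unique (map_zero _) ?_ (map_one _)).symm
  simp

theorem map_exp_subst {S : Type*} [CommRing S] [Algebra ℚ S] (φ : R →+* S)
    {ψ : MvPowerSeries σ R} (hψ : constantCoeff ψ = 0) :
    MvPowerSeries.map φ ((PowerSeries.exp R).subst ψ)
      = (PowerSeries.exp S).subst (MvPowerSeries.map φ ψ) := by
  rw [PowerSeries.map_subst (PowerSeries.HasSubst.of_constantCoeff_zero hψ), PowerSeries.map_exp]

theorem rescale_exp_subst (a : σ → R) {ψ : MvPowerSeries σ R} (hψ : constantCoeff ψ = 0) :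
    rescale a ((PowerSeries.exp R).subst ψ) = (PowerSeries.exp R).subst (rescale a ψ) := by
  have he (f : MvPowerSeries σ R) : euler (rescale a f) = rescale a (euler f) := by
    ext d
    rw [coeff_euler, coeff_rescale, coeff_rescale, coeff_euler]
    ring
  have h0 (f : MvPowerSeries σ R) : constantCoeff (rescale a f) = constantCoeff f := by
    rw [← coeff_zero_eq_constantCoeff_apply, coeff_rescale]
    simp
  refine exp_subst_unique (by rw [h0, hψ]) ?_ ?_
  · rw [he, he, ← map_mul, euler_exp_subst hψ]
  · rw [h0, constantCoeff_exp_subst hψ]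

theorem constantCoeff_log_subst {φ : MvPowerSeries σ R} (hφ : constantCoeff φ = 1) :
    constantCoeff ((PowerSeries.log R).subst (φ - 1)) = 0 := by
  rw [← coeff_zero_eq_constantCoeff_apply,
    coeff_subst_eq_sum_range _ (by simp [hφ]) (n := 1) (by simp)]
  simp

theorem mul_euler_log_subst {φ : MvPowerSeries σ R} (hφ : constantCoeff φ = 1) :
    φ * euler ((PowerSeries.log R).subst (φ - 1)) = euler φ := by
  have h0 : constantCoeff (φ - 1) = 0 := by simp [hφ]
  have hs := PowerSeries.HasSubst.of_constantCoeff_zero h0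
  -- The derivative of the logarithm series is the geometric series `1 / (1 + X)`; substituting `φ -
  -- 1` turns the factor `1 + X` into `φ`.
  have h1 : (1 + PowerSeries.X) * PowerSeries.derivative R (PowerSeries.log R) = 1 := by
    rw [PowerSeries.deriv_log]
    ext n
    rw [add_mul, one_mul, map_add]
    cases n with
    | zero => simp
    | succ n =>
      rw [PowerSeries.coeff_succ_X_mul]
      simp [pow_succ, PowerSeries.coeff_one]
  have h2 := congrArg (PowerSeries.substAlgHom hs) h1
  rw [map_mul, map_add, map_one, PowerSeries.substAlgHom_X hs, add_sub_cancel,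
    PowerSeries.coe_substAlgHom hs] at h2
  rw [euler_subst _ h0, ← mul_assoc, h2, one_mul, map_sub, Derivation.map_one_eq_zero, sub_zero]

theorem exp_subst_log_subst {φ : MvPowerSeries σ R} (hφ : constantCoeff φ = 1) :
    (PowerSeries.exp R).subst ((PowerSeries.log R).subst (φ - 1)) = φ :=
  (exp_subst_unique (constantCoeff_log_subst hφ) (mul_euler_log_subst hφ).symm hφ).symm

/-- The exponential is injective on series without constant term. -/
theorem exp_subst_injective {ψ χ : MvPowerSeries σ R} (hψ : constantCoeff ψ = 0)
    (hχ : constantCoeff χ = 0)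
    (h : (PowerSeries.exp R).subst ψ = (PowerSeries.exp R).subst χ) : ψ = χ := by
  -- Cancelling the common exponential, a unit, from the two differential equations.
  have key : euler ψ = euler χ := by
    have h1 := euler_exp_subst hψ
    rw [h, euler_exp_subst hχ] at h1
    have h2 := congrArg ((PowerSeries.exp R).subst (-χ) * ·) h1
    simp only [← mul_assoc] at h2
    rwa [mul_comm (PowerSeries.subst (-χ) _), exp_subst_mul_exp_subst_neg hχ, one_mul, one_mul,
      eq_comm] at h2
  rw [← sub_eq_zero]
  refine eq_of_euler_eq_mul (map_zero (constantCoeff (σ := σ) (R := R))) ?_ ?_ ?_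
  · rw [map_sub, key, sub_self, mul_zero]
  · simp
  · simp [hψ, hχ]

end Euler

/-! ### Algebraicity of the cofactor of a monic factor. -/

section Factorization

open Polynomial

variable {R A : Type*} [CommRing R] [IsDomain R] [CommRing A] [IsDomain A] [Algebra R A]

/-- If a nonzero polynomial over `R` is the product of a monic polynomial `W` and a polynomial `U`
over an extension domain, then the coefficients of `U` are algebraic over `R`. -/
theorem isAlgebraic_coeff_of_monic_mul {N : R[X]} {W U : A[X]} (hN : N ≠ 0) (hW : W.Monic)
    (h : N.map (algebraMap R A) = W * U) (i : ℕ) : IsAlgebraic R (U.coeff i) := by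
  let K := AlgebraicClosure (FractionRing A)
  have hAK : Function.Injective (algebraMap A K) := by
    rw [IsScalarTower.algebraMap_eq A (FractionRing A) K]
    exact (algebraMap (FractionRing A) K).injective.comp (IsFractionRing.injective A _)
  let S := Subalgebra.algebraicClosure R K
  have hNK : N.map (algebraMap R K) = W.map (algebraMap A K) * U.map (algebraMap A K) := by
    rw [IsScalarTower.algebraMap_eq R A K, ← Polynomial.map_map, h, Polynomial.map_mul]
  have hWm : (W.map (algebraMap A K)).Monic := hW.map _
  -- A root of `W` is a root of `N`, whose coefficients lie in `R`. As `W` is monic and splits over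
  -- `K`, it is a product of factors `X - z` defined over `S`.
  have hroots : ∀ z ∈ (W.map (algebraMap A K)).roots, z ∈ S := by
    intro z hz
    refine ⟨N, hN, ?_⟩
    rw [Polynomial.aeval_def, ← Polynomial.eval_map, hNK, eval_mul,
      (Polynomial.mem_roots'.mp hz).2, zero_mul]
  have hWS : W.map (algebraMap A K) ∈ Polynomial.lifts (algebraMap S K) := by
    have hs := IsAlgClosed.splits (W.map (algebraMap A K))
    rw [hs.eq_prod_roots_of_monic hWm]
    refine Submonoid.multiset_prod_mem _ _ fun p hp => ?_
    obtain ⟨z, hz, rfl⟩ := Multiset.mem_map.mp hp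
    exact ⟨X - C ⟨z, hroots z hz⟩, by simp [S]⟩
  obtain ⟨W', hW', -, hW'm⟩ := Polynomial.lifts_and_natDegree_eq_and_monic hWS hWm
  -- Division by a monic polynomial commutes with base change, so the quotient `U` can be computed
  -- over `S`.
  have hU : U.map (algebraMap A K)
      = ((N.map (algebraMap R S)) /ₘ W').map (algebraMap S K) := by
    rw [Polynomial.map_divByMonic _ hW'm, Polynomial.map_map, ← IsScalarTower.algebraMap_eq, hNK,
      hW', Polynomial.mul_divByMonic_cancel_left _ hWm]
  have hi := congrArg (fun p => p.coeff i) hU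
  simp only [Polynomial.coeff_map] at hi
  rw [← isAlgebraic_algebraMap_iff hAK, hi]
  exact (((N.map (algebraMap R S)) /ₘ W').coeff i).2

end Factorization

/-! ### Laurent polynomials in `t`: splitting and reflection. -/

section Laurent

open Polynomial LaurentPolynomial

theorem coeff_T_mul (s : ℂ[T;T⁻¹]) (m n : ℤ) : (T m * s).coeff n = s.coeff (n - m) := by
  rw [T, AddMonoidAlgebra.coeff_single_mul_eq_mul_coeff (n - m) 
      (fun k _ => by constructor <;> intro <;> omega), one_mul]

theorem coeff_zero_C_mul_T (c : ℂ) (n : ℤ) :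
    (LaurentPolynomial.C c * T n : ℂ[T;T⁻¹]).coeff 0 = if n = 0 then c else 0 := by
  rw [mul_comm, coeff_T_mul, C_apply]
  simp

/-- The constant term goes entirely to `q`. This makes the negative factor monic after
multiplication by `t^a` and leaves the twist as the constant term of the nonnegative part. -/
theorem exists_toLaurent_invert_add_toLaurent (s : ℂ[T;T⁻¹]) :
    ∃ p q : ℂ[X], p.coeff 0 = 0 ∧ q.coeff 0 = s.coeff 0 ∧
      invert (toLaurent p) + toLaurent q = s := by
  induction s using LaurentPolynomial.induction_on' with
  | add s t hs ht =>
    obtain ⟨p, q, h1, h2, h3⟩ := hs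
    obtain ⟨p', q', h1', h2', h3'⟩ := ht
    refine ⟨p + p', q + q', by simp [h1, h1'], by simp [h2, h2'], ?_⟩
    rw [← h3, ← h3']
    simp only [map_add]
    ring
  | C_mul_T n a =>
    obtain ⟨m, rfl | rfl⟩ := n.eq_nat_or_neg
    · exact ⟨0, Polynomial.C a * X ^ m, by simp, by
        rw [coeff_zero_C_mul_T]
        simp [Polynomial.coeff_X_pow, eq_comm], by simp⟩
    · by_cases hm : m = 0
      · subst hm
        exact ⟨0, Polynomial.C a, by simp, by simp, by simp⟩
      · exact ⟨Polynomial.C a * X ^ m, 0, by simp [Polynomial.coeff_X_pow, Ne.symm hm], by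
          rw [coeff_zero_C_mul_T]
          simp [hm], by simp⟩

theorem coeff_toLaurent_natCast (q : ℂ[X]) (n : ℕ) : (toLaurent q).coeff (n : ℤ) = q.coeff n := by
  rw [coeff_toLaurent]
  exact Finsupp.mapDomain_apply Nat.castEmbedding.injective _ _

theorem coeff_toLaurent_of_neg (q : ℂ[X]) {n : ℤ} (hn : n < 0) : (toLaurent q).coeff n = 0 := by
  rw [coeff_toLaurent]
  refine Finsupp.mapDomain_of_notMem_range _ _ ?_
  rintro ⟨m, rfl⟩
  exact absurd hn (by simp)

/-- The left side has only powers at most `a`, with `p.coeff 0` at `t^a`. This gives the degree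
bounds for both factors and the leading coefficient of the monic one. -/
theorem reflect_of_T_mul_invert_eq {p q : ℂ[X]} {a : ℕ}
    (h : T a * invert (toLaurent p) = toLaurent q) :
    q.natDegree ≤ a ∧ q.coeff a = p.coeff 0 := by
  have key (n : ℤ) : (toLaurent p).coeff (a - n) = (toLaurent q).coeff n := by
    rw [← h, coeff_T_mul, invert_apply, neg_sub]
  constructor
  · rw [Polynomial.natDegree_le_iff_coeff_eq_zero]
    intro n hn
    rw [← coeff_toLaurent_natCast, ← key, coeff_toLaurent_of_neg _ (by omega)]
  · rw [← coeff_toLaurent_natCast, ← key, sub_self]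
    exact coeff_toLaurent_natCast p 0

theorem exists_T_mul_invert_eq {q : ℂ[X]} {a : ℕ} (h : q.natDegree ≤ a) :
    ∃ p : ℂ[X], T a * invert (toLaurent p) = toLaurent q := by
  rw [Polynomial.as_sum_range' q (a + 1) (by omega)]
  refine ⟨∑ i ∈ range (a + 1), Polynomial.C (q.coeff i) * X ^ (a - i), ?_⟩
  rw [map_sum, map_sum, map_sum, mul_sum]
  refine sum_congr rfl fun i hi => ?_
  rw [← Polynomial.C_mul_X_pow_eq_monomial, toLaurent_C_mul_X_pow, toLaurent_C_mul_X_pow, map_mul,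
    invert_T, invert_C, mul_left_comm, ← T_add]
  congr 2
  have := mem_range.mp hi
  push_cast [show i ≤ a by omega]
  ring

end Laurent

/-! ### The factorization in `t` and part (1). -/

section Twist

open MvPowerSeries LaurentPolynomial
open Polynomial (toLaurent)

/-- Polynomials in `t` over `ℂ[[x, y]]`, seen as series in `x, y` over `ℂ[t]`. -/
def polyToSeries : Polynomial (MvPowerSeries (Fin 2) ℂ) →+* MvPowerSeries (Fin 2) (Polynomial ℂ) :=
  Polynomial.eval₂RingHom (MvPowerSeries.map Polynomial.C) (MvPowerSeries.C Polynomial.X)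

theorem coeff_coeff_polyToSeries (p : Polynomial (MvPowerSeries (Fin 2) ℂ)) (d : Fin 2 →₀ ℕ)
    (k : ℕ) : (coeff d (polyToSeries p)).coeff k = coeff d (p.coeff k) := by
  induction p using Polynomial.induction_on' with
  | add p q hp hq => simp only [map_add, Polynomial.coeff_add, hp, hq]
  | monomial n f =>
    rw [polyToSeries, Polynomial.coe_eval₂RingHom, Polynomial.eval₂_monomial, ← map_pow,
      MvPowerSeries.coeff_mul_C, coeff_map, Polynomial.coeff_C_mul_X_pow, Polynomial.coeff_monomial]
    by_cases h : n = k
    · simp [h]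
    · simp [h, Ne.symm h]

theorem polyToSeries_injective : Function.Injective polyToSeries := by
  intro p q h
  ext k d
  rw [← coeff_coeff_polyToSeries, h, coeff_coeff_polyToSeries]

/-- The bound `a`, uniform in `d`, is essential: a series over `ℂ[t]` may otherwise involve
infinitely many powers of `t`. -/
theorem exists_polyToSeries_eq {w : MvPowerSeries (Fin 2) (Polynomial ℂ)} {a : ℕ}
    (hw : ∀ d, (coeff d w).natDegree ≤ a) :
    ∃ W : Polynomial (MvPowerSeries (Fin 2) ℂ), W.natDegree ≤ a ∧ polyToSeries W = w := by
  let c (k : ℕ) : MvPowerSeries (Fin 2) ℂ := fun d => (coeff d w).coeff k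
  refine ⟨∑ k ∈ range (a + 1), Polynomial.monomial k (c k), ?_, ?_⟩
  · refine Polynomial.natDegree_sum_le_of_forall_le _ _ fun k hk => ?_
    exact (Polynomial.natDegree_monomial_le _).trans (by have := mem_range.mp hk; omega)
  · ext d k
    rw [coeff_coeff_polyToSeries, Polynomial.finsetSum_coeff]
    simp only [Polynomial.coeff_monomial, sum_ite_eq', mem_range]
    split_ifs with h
    · rfl
    · rw [map_zero, Polynomial.coeff_eq_zero_of_natDegree_lt ((hw d).trans_lt (by omega))]

/-- Coefficientwise inclusion `ℂ[t] → ℂ[t, t⁻¹]`. -/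
abbrev posMap : MvPowerSeries (Fin 2) (Polynomial ℂ) →+* MvPowerSeries (Fin 2) ℂ[T;T⁻¹] :=
  MvPowerSeries.map toLaurent

/-- Coefficientwise inclusion `ℂ[t⁻¹] → ℂ[t, t⁻¹]`. -/
abbrev negMap : MvPowerSeries (Fin 2) (Polynomial ℂ) →+* MvPowerSeries (Fin 2) ℂ[T;T⁻¹] :=
  MvPowerSeries.map ((invert (R := ℂ)).toRingEquiv.toRingHom.comp toLaurent)

theorem coeff_negMap (f : MvPowerSeries (Fin 2) (Polynomial ℂ)) (d : Fin 2 →₀ ℕ) :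
    coeff d (negMap f) = invert (toLaurent (coeff d f)) := rfl

theorem coeff_posMap (f : MvPowerSeries (Fin 2) (Polynomial ℂ)) (d : Fin 2 →₀ ℕ) :
    coeff d (posMap f) = toLaurent (coeff d f) := rfl

/-- The substitution `x ↦ x (1 + t) / t`, `y ↦ y (1 + t)`, whose constant term in `t` is
`binomTwist`. -/
def twistHom : MvPowerSeries (Fin 2) ℂ →+* MvPowerSeries (Fin 2) ℂ[T;T⁻¹] :=
  (rescale ![T (-1) * (1 + T 1), 1 + T 1]).comp (MvPowerSeries.map LaurentPolynomial.C)

theorem twistHom_C (c : ℂ) :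
    twistHom (MvPowerSeries.C c) = MvPowerSeries.C (LaurentPolynomial.C c) := by
  classical
  ext1 d
  rw [twistHom, RingHom.comp_apply, coeff_rescale, MvPowerSeries.map_C, coeff_C]
  split_ifs with h
  · simp [h]
  · simp

theorem twistHom_X (i : Fin 2) : twistHom (X i)
    = MvPowerSeries.C ((![T (-1) * (1 + T 1), 1 + T 1] : Fin 2 → ℂ[T;T⁻¹]) i) * X i := by
  classical
  ext1 d
  rw [twistHom, RingHom.comp_apply, coeff_rescale, MvPowerSeries.map_X, coeff_C_mul, coeff_X]
  split_ifs with h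
  · simp [h]
  · simp

theorem coeff_zero_coeff_twistHom (f : MvPowerSeries (Fin 2) ℂ) (d : Fin 2 →₀ ℕ) :
    (coeff d (twistHom f)).coeff 0 = coeff d (binomTwist f) := by
  have h : coeff d (twistHom f)
      = T (-(d 0 : ℤ)) * toLaurent ((1 + Polynomial.X) ^ (d 0 + d 1) * Polynomial.C (coeff d f)) := by
    rw [twistHom, RingHom.comp_apply, coeff_rescale, coeff_map,
      Finsupp.prod_fintype _ _ (fun _ => pow_zero _), Fin.prod_univ_two]
    simp only [Matrix.cons_val_zero, Matrix.cons_val_one, mul_pow, T_pow, map_mul, map_pow, map_add,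
      map_one, Polynomial.toLaurent_X, Polynomial.toLaurent_C, pow_add]
    rw [mul_neg_one]
    ring
  rw [h, coeff_T_mul, zero_sub, neg_neg, coeff_toLaurent_natCast, Polynomial.coeff_mul_C,
    Polynomial.coeff_one_add_X_pow]
  rfl

theorem algebraMap_eq_coe (P : MvPolynomial (Fin 2) ℂ) :
    algebraMap (MvPolynomial (Fin 2) ℂ) (MvPowerSeries (Fin 2) ℂ) P = P := by
  rw [MvPowerSeries.algebraMap_apply', Algebra.algebraMap_self, MvPowerSeries.map_id,
    RingHom.id_apply]

/-- Clears the denominators in `t`. Each multiplication by `x` costs one more factor `t`;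
multiplication by `y` costs none. -/
theorem exists_polynomial_twistHom (P : MvPolynomial (Fin 2) ℂ) :
    ∃ (a : ℕ) (N : Polynomial (MvPolynomial (Fin 2) ℂ)),
      posMap (polyToSeries (N.map (algebraMap _ _)))
        = MvPowerSeries.C (T a) * twistHom (P : MvPowerSeries (Fin 2) ℂ) := by
  have hC (g : MvPowerSeries (Fin 2) ℂ) :
      posMap (polyToSeries (Polynomial.C g)) = MvPowerSeries.map LaurentPolynomial.C g := by
    rw [polyToSeries, Polynomial.coe_eval₂RingHom, Polynomial.eval₂_C]
    ext1 d
    simp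
  have hX : posMap (polyToSeries Polynomial.X) = MvPowerSeries.C (T 1) := by
    rw [polyToSeries, Polynomial.coe_eval₂RingHom, Polynomial.eval₂_X, posMap,
      MvPowerSeries.map_C, Polynomial.toLaurent_X]
  induction P using MvPolynomial.induction_on with
  | C c =>
    refine ⟨0, Polynomial.C (MvPolynomial.C c), ?_⟩
    rw [Polynomial.map_C, hC, algebraMap_eq_coe, MvPolynomial.coe_C, twistHom_C]
    simp
  | add p q hp hq =>
    obtain ⟨a, N, hN⟩ := hp
    obtain ⟨b, M, hM⟩ := hq
    refine ⟨a + b, Polynomial.X ^ b * N + Polynomial.X ^ a * M, ?_⟩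
    simp only [Polynomial.map_add, Polynomial.map_mul, Polynomial.map_pow, Polynomial.map_X,
      map_add, map_mul, map_pow, hN, hM, hX, MvPolynomial.coe_add, Nat.cast_add, T_add]
    simp only [← map_pow, T_pow, mul_one]
    ring
  | mul_X p i hp =>
    obtain ⟨a, N, hN⟩ := hp
    have hXi (i : Fin 2) : posMap (polyToSeries (Polynomial.C (X i))) = X i := by
      rw [hC, MvPowerSeries.map_X]
    have hT : (MvPowerSeries.C (T 1) * MvPowerSeries.C (T (-1)) : MvPowerSeries (Fin 2) ℂ[T;T⁻¹])
        = 1 := by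
      rw [← map_mul, ← T_add, add_neg_cancel, T_zero, map_one]
    have h0 := twistHom_X 0
    have h1 := twistHom_X 1
    rw [Matrix.cons_val_zero, map_mul, map_add, map_one] at h0
    rw [Matrix.cons_val_one, Matrix.cons_val_fin_one, map_add, map_one] at h1
    have hN' (i : Fin 2) : posMap (polyToSeries
        ((N * Polynomial.C (MvPolynomial.X i) * (1 + Polynomial.X)).map (algebraMap _ _)))
        = MvPowerSeries.C (T a) * twistHom p * X i * (1 + MvPowerSeries.C (T 1)) := by
      rw [Polynomial.map_mul, Polynomial.map_mul, Polynomial.map_C, algebraMap_eq_coe,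
        MvPolynomial.coe_X, Polynomial.map_add, Polynomial.map_one, Polynomial.map_X, map_mul,
        map_mul, map_mul, map_mul, hN, hXi, map_add, map_add, map_one, map_one, hX]
    revert i
    rw [Fin.forall_fin_two]
    constructor
    · refine ⟨a + 1, _, (hN' 0).trans ?_⟩
      rw [MvPolynomial.coe_mul, map_mul, MvPolynomial.coe_X, h0, Nat.cast_add, T_add, map_mul,
        Nat.cast_one]
      linear_combination (-MvPowerSeries.C (T a) * twistHom p * X 0
        * (1 + MvPowerSeries.C (T 1))) * hT
    · refine ⟨a, _, (hN' 1).trans ?_⟩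
      rw [MvPolynomial.coe_mul, map_mul, MvPolynomial.coe_X, h1]
      ring

theorem isAlgebraicSeries_mvExp_binomTwist_mvLog (P : MvPolynomial (Fin 2) ℂ)
    (hP : MvPolynomial.constantCoeff P = 1) :
    IsAlgebraicSeries (mvExp (binomTwist (mvLog (P : MvPowerSeries (Fin 2) ℂ)))) := by
  have hP1 : constantCoeff (P : MvPowerSeries (Fin 2) ℂ) = 1 := by
    rw [← coeff_zero_eq_constantCoeff_apply, MvPolynomial.coeff_coe]
    exact hP
  set L := mvLog (P : MvPowerSeries (Fin 2) ℂ)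
  have hL0 : constantCoeff L = 0 := constantCoeff_log_subst hP1
  have hL : mvExp L = P := exp_subst_log_subst hP1
  -- splitting into negative and nonnegative powers of `t`
  have hsplit (d : Fin 2 →₀ ℕ) : ∃ p q : Polynomial ℂ, p.coeff 0 = 0 ∧
      q.coeff 0 = (coeff d (twistHom L)).coeff 0 ∧
      invert (toLaurent p) + toLaurent q = coeff d (twistHom L) ∧ (d = 0 → p = 0 ∧ q = 0) := by
    -- The zero polynomials are chosen explicitly at `d = 0`, so that both parts have zero constant
    -- coefficient and can be exponentiated.
    by_cases hd : d = 0
    · have : coeff d (twistHom L) = 0 := by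
        rw [hd, twistHom, RingHom.comp_apply, coeff_rescale, coeff_map,
          coeff_zero_eq_constantCoeff_apply, hL0, map_zero, mul_zero]
      exact ⟨0, 0, by simp [this]⟩
    · obtain ⟨p, q, h1, h2, h3⟩ := exists_toLaurent_invert_add_toLaurent (coeff d (twistHom L))
      exact ⟨p, q, h1, h2, h3, fun h => absurd h hd⟩
  choose p q hp0 hq0 hpq hd0 using hsplit
  let gneg : MvPowerSeries (Fin 2) (Polynomial ℂ) := p
  let gpos : MvPowerSeries (Fin 2) (Polynomial ℂ) := q
  have hneg0 : constantCoeff gneg = 0 := (hd0 0 rfl).1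
  have hpos0 : constantCoeff gpos = 0 := (hd0 0 rfl).2
  have hnegm0 : constantCoeff (negMap gneg) = 0 := by
    rw [negMap, constantCoeff_map, hneg0, map_zero]
  have hposm0 : constantCoeff (posMap gpos) = 0 := by
    rw [posMap, constantCoeff_map, hpos0, map_zero]
  have hg : negMap gneg + posMap gpos = twistHom L := by
    ext1 d
    exact hpq d
  let E (g : MvPowerSeries (Fin 2) (Polynomial ℂ)) := (PowerSeries.exp (Polynomial ℂ)).subst g
  have hG : negMap (E gneg) * posMap (E gpos) = twistHom (P : MvPowerSeries (Fin 2) ℂ) := by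
    have h0 : constantCoeff (MvPowerSeries.map (LaurentPolynomial.C (R := ℂ)) L) = 0 := by
      rw [constantCoeff_map, hL0, map_zero]
    rw [negMap, posMap, map_exp_subst _ hneg0, map_exp_subst _ hpos0, ← exp_subst_add hnegm0 hposm0,
      hg, ← hL, twistHom, RingHom.comp_apply, RingHom.comp_apply, mvExp, map_exp_subst _ hL0,
      rescale_exp_subst _ h0]
  have hnegE : E gneg * E (-gneg) = 1 := exp_subst_mul_exp_subst_neg hneg0
  have hposE : E gpos * E (-gpos) = 1 := exp_subst_mul_exp_subst_neg hpos0
  obtain ⟨a, N, hN⟩ := exists_polynomial_twistHom P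
  set n := polyToSeries (N.map (algebraMap _ _)) with hn
  -- the distinguished factor
  have hw : MvPowerSeries.C (T a) * negMap (E gneg) = posMap (n * E (-gpos)) := by
    rw [map_mul, hN, ← hG, mul_assoc, mul_assoc, ← map_mul, hposE, map_one, mul_one]
  -- By `hw`, the same coefficient is `t^a` times a polynomial in `t⁻¹` and also a polynomial in
  -- `t`.
  have hwd (d) := reflect_of_T_mul_invert_eq (p := coeff d (E gneg)) (q := coeff d (n * E (-gpos)))
    (a := a) (by
      have := congrArg (coeff d) hw
      rwa [coeff_C_mul, coeff_negMap, coeff_posMap] at this)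
  obtain ⟨W, hWdeg, hW⟩ := exists_polyToSeries_eq fun d => (hwd d).1
  have hWm : W.Monic := by
    refine Polynomial.monic_of_natDegree_le_of_coeff_eq_one a hWdeg ?_
    -- The variable of `gneg` stands for `t⁻¹`. Setting it to zero kills `gneg`, so its exponential
    -- becomes `1`, and this is the coefficient of `t^a` in `W`.
    have h1 : MvPowerSeries.map (Polynomial.constantCoeff (R := ℂ)) (E gneg) = 1 := by
      have h2 : MvPowerSeries.map (Polynomial.constantCoeff (R := ℂ)) gneg = 0 := by
        ext1 d
        exact hp0 d
      rw [map_exp_subst _ hneg0, h2, ← exp_subst_unique (map_zero _) (E := 1) (by simp) (map_one _)]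
    ext1 d
    rw [← coeff_coeff_polyToSeries, hW, (hwd d).2, ← h1]
    rfl
  -- the unit factor
  have hu : MvPowerSeries.C (T a) * posMap (E gpos) = posMap n * negMap (E (-gneg)) := by
    rw [hN, ← hG, mul_comm (negMap _), mul_assoc, mul_assoc, ← map_mul, hnegE, map_one, mul_one]
  have hud (d) : (coeff d (E gpos)).natDegree ≤
      (N.map (algebraMap _ (MvPowerSeries (Fin 2) ℂ))).natDegree := by
    set b := (N.map (algebraMap _ (MvPowerSeries (Fin 2) ℂ))).natDegree
    have hnb (e) : (coeff e n).natDegree ≤ b := by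
      rw [Polynomial.natDegree_le_iff_coeff_eq_zero]
      intro k hk
      rw [coeff_coeff_polyToSeries, Polynomial.coeff_eq_zero_of_natDegree_lt hk, map_zero]
    -- With `b` bounding the `t`-degree of `N`, reflection writes `n` as `t^b` times a series in
    -- `t⁻¹`. Then `t^a * E gpos` has only powers at most `b`.
    choose r hr using fun e => exists_T_mul_invert_eq (hnb e)
    let m : MvPowerSeries (Fin 2) (Polynomial ℂ) := r
    have hm : posMap n = MvPowerSeries.C (T b) * negMap m := by
      ext1 e
      rw [coeff_C_mul, coeff_negMap, coeff_posMap]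
      exact (hr e).symm
    have h1 := congrArg (coeff d) hu
    rw [hm, mul_assoc, ← map_mul, coeff_C_mul, coeff_C_mul, coeff_posMap, coeff_negMap,
      ← Polynomial.toLaurent_X_pow, ← map_mul] at h1
    have h2 := (reflect_of_T_mul_invert_eq h1.symm).1
    by_cases h0 : coeff d (E gpos) = 0
    · simp [h0]
    · rw [Polynomial.natDegree_mul (pow_ne_zero _ Polynomial.X_ne_zero) h0] at h2
      omega
  obtain ⟨U, -, hU⟩ := exists_polyToSeries_eq hud
  have hWU : N.map (algebraMap _ _) = W * U := by
    apply polyToSeries_injective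
    rw [map_mul, hW, hU, mul_assoc, mul_comm (E (-gpos)), hposE, mul_one]
  have hval : mvExp (binomTwist L) = U.coeff 0 := by
    have h1 : binomTwist L = MvPowerSeries.map (Polynomial.constantCoeff (R := ℂ)) gpos := by
      ext1 d
      rw [← coeff_zero_coeff_twistHom, ← hq0]
      rfl
    ext1 d
    rw [h1, mvExp, ← map_exp_subst _ hpos0, ← coeff_coeff_polyToSeries, hU]
    rfl
  have hN0 : N ≠ 0 := by
    rintro rfl
    have hU0 : U ≠ 0 := by
      rintro rfl
      rw [map_zero] at hU
      rw [← hU, zero_mul] at hposE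
      exact zero_ne_one hposE
    exact mul_ne_zero hWm.ne_zero hU0 (by rw [← hWU, Polynomial.map_zero])
  rw [hval]
  have : IsDomain (MvPowerSeries (Fin 2) ℂ) := NoZeroDivisors.to_isDomain _
  exact isAlgebraic_coeff_of_monic_mul hN0 hWm hWU 0

end Twist

/-! ### From polynomials to rational functions. -/

section Rational

open MvPowerSeries

theorem binomTwist_add (f g : MvPowerSeries (Fin 2) ℂ) :
    binomTwist (f + g) = binomTwist f + binomTwist g := by
  ext d
  exact mul_add _ _ _

theorem constantCoeff_binomTwist {f : MvPowerSeries (Fin 2) ℂ} (hf : constantCoeff f = 0) :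
    constantCoeff (binomTwist f) = 0 :=
  (congrArg _ hf).trans (mul_zero _)

theorem constantCoeff_coe_mvPolynomial (P : MvPolynomial (Fin 2) ℂ) :
    constantCoeff (P : MvPowerSeries (Fin 2) ℂ) = MvPolynomial.constantCoeff P := by
  rw [← coeff_zero_eq_constantCoeff_apply, MvPolynomial.coeff_coe]
  rfl

/-- A rational power series is a quotient whose denominator does not vanish at the origin. -/
theorem IsRationalSeries.exists_constantCoeff_eq_one {φ : MvPowerSeries (Fin 2) ℂ}
    (hφ : IsRationalSeries φ) : ∃ P Q : MvPolynomial (Fin 2) ℂ,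
      MvPolynomial.constantCoeff Q = 1 ∧
        (Q : MvPowerSeries (Fin 2) ℂ) * φ = (P : MvPowerSeries (Fin 2) ℂ) := by
  obtain ⟨P, Q, hQ, h⟩ := hφ
  let I := MvPolynomial.idealOfVars (Fin 2) ℂ
  let M := MvPolynomial (Fin 2) ℂ ⧸ Ideal.span {Q}
  have hself (p : MvPolynomial (Fin 2) ℂ) (n : ℕ) :
      p - truncTotal n (p : MvPowerSeries (Fin 2) ℂ) ∈ I ^ n :=
    (MvPolynomial.mem_pow_idealOfVars_iff' ..).mpr fun x hx => by simp [coeff_truncTotal _ hx]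
  -- Krull's intersection theorem, at the ideal `I` of the origin: `P` is congruent modulo `Q` to `P
  -- - Q * truncTotal n φ`, which lies in `I ^ n`.
  have hmem : (Ideal.Quotient.mk (Ideal.span {Q}) P : M) ∈
      (⨅ i : ℕ, I ^ i • ⊤ : Submodule (MvPolynomial (Fin 2) ℂ) M) := by
    rw [Submodule.mem_iInf]
    intro n
    have hr : P - Q * truncTotal n φ ∈ I ^ n := by
      have h1 := truncTotal_mul_sub_mul_truncTotal_mem_pow_idealOfVars (n := n)
        (Q : MvPowerSeries (Fin 2) ℂ) φ
      rw [h] at h1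
      have h2 := (I ^ n).add_mem ((I ^ n).sub_mem (hself P n)
        ((I ^ n).mul_mem_right (truncTotal n φ) (hself Q n))) h1
      convert h2 using 1
      ring
    have hmk : (Ideal.Quotient.mk (Ideal.span {Q}) P : M)
        = (P - Q * truncTotal n φ) • (1 : M) := by
      change _ = Ideal.Quotient.mk (Ideal.span {Q}) ((P - Q * truncTotal n φ) * 1)
      rw [mul_one, Ideal.Quotient.eq, sub_sub_cancel]
      exact Ideal.mul_mem_right _ _ (Ideal.mem_span_singleton_self Q)
    rw [hmk]
    exact Submodule.smul_mem_smul hr trivial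
  -- Krull gives `r ∈ I` with `r P ≡ P` modulo `Q`. Thus `(1 - r) P = Q P'`, and cancelling `Q`
  -- makes `1 - r` a denominator of `φ` with value `1` at the origin.
  obtain ⟨⟨r, hrI⟩, hr⟩ := (I.mem_iInf_smul_pow_eq_bot_iff _).mp hmem
  have hr0 : MvPolynomial.constantCoeff r = 0 := by
    have := (MvPolynomial.mem_pow_idealOfVars_iff' 1 r).mp (by rwa [pow_one]) 0 (by simp)
    exact this
  have hdvd : Q ∣ P - r * P := by
    rw [← Ideal.mem_span_singleton, ← Ideal.Quotient.eq]
    exact hr.symm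
  obtain ⟨P', hP'⟩ := hdvd
  refine ⟨P', 1 - r, by rw [map_sub, map_one, hr0, sub_zero], ?_⟩
  have hQ' : (Q : MvPowerSeries (Fin 2) ℂ) ≠ 0 := by
    rwa [Ne, MvPolynomial.coe_eq_zero_iff]
  refine mul_left_cancel₀ hQ' ?_
  rw [← MvPolynomial.coe_mul, ← hP', mul_left_comm, h, ← MvPolynomial.coe_mul]
  congr 1
  ring

theorem isAlgebraicSeries_mvExp_binomTwist_mvLog_of_isRationalSeries
    {φ : MvPowerSeries (Fin 2) ℂ} (hφ : IsRationalSeries φ) (hφ1 : constantCoeff φ = 1) :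
    IsAlgebraicSeries (mvExp (binomTwist (mvLog φ))) := by
  obtain ⟨P, Q, hQ, h⟩ := hφ.exists_constantCoeff_eq_one
  have hQ1 : constantCoeff (Q : MvPowerSeries (Fin 2) ℂ) = 1 := by
    rw [constantCoeff_coe_mvPolynomial, hQ]
  have hP1 : constantCoeff (P : MvPowerSeries (Fin 2) ℂ) = 1 := by
    rw [← h, map_mul, hQ1, hφ1, one_mul]
  have hlQ : constantCoeff (mvLog (Q : MvPowerSeries (Fin 2) ℂ)) = 0 := constantCoeff_log_subst hQ1
  have hlP : constantCoeff (mvLog (P : MvPowerSeries (Fin 2) ℂ)) = 0 := constantCoeff_log_subst hP1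
  have hlφ : constantCoeff (mvLog φ) = 0 := constantCoeff_log_subst hφ1
  have hlog : mvLog (Q : MvPowerSeries (Fin 2) ℂ) + mvLog φ = mvLog P := by
    refine exp_subst_injective (by rw [map_add, hlQ, hlφ, add_zero]) hlP ?_
    rw [exp_subst_add hlQ hlφ]
    simp only [mvLog, exp_subst_log_subst hQ1, exp_subst_log_subst hφ1, exp_subst_log_subst hP1, h]
  have hbQ := constantCoeff_binomTwist hlQ
  have hbφ := constantCoeff_binomTwist hlφ
  have hexp : mvExp (binomTwist (mvLog (Q : MvPowerSeries (Fin 2) ℂ))) * mvExp (binomTwist (mvLog φ))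
      = mvExp (binomTwist (mvLog P)) := by
    rw [← hlog, binomTwist_add]
    exact (exp_subst_add hbQ hbφ).symm
  have hinv := exp_subst_mul_exp_subst_neg hbQ
  let _ : Invertible (mvExp (binomTwist (mvLog (Q : MvPowerSeries (Fin 2) ℂ)))) :=
    ⟨_, (mul_comm _ _).trans hinv, hinv⟩
  have hQa : IsAlgebraicSeries _ := isAlgebraicSeries_mvExp_binomTwist_mvLog Q hQ
  have hPa : IsAlgebraicSeries _ := isAlgebraicSeries_mvExp_binomTwist_mvLog P
    (by rw [← constantCoeff_coe_mvPolynomial, hP1])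
  have : mvExp (binomTwist (mvLog φ)) = ⅟(mvExp (binomTwist (mvLog (Q : MvPowerSeries (Fin 2) ℂ))))
      * mvExp (binomTwist (mvLog P)) := by
    rw [← hexp, invOf_mul_cancel_left]
  rw [this]
  exact (IsAlgebraic.invOf hQa).mul hPa

end Rational

/-! ### Abelianization of noncommutative series. -/

section Abelianization

open MvPowerSeries NCSeries

theorem mem_lists_toMultiset (d : Fin 2 →₀ ℕ) (w : List (Fin 2)) :
    w ∈ (Finsupp.toMultiset d).lists.toFinset ↔ Multiset.toFinsupp (w : Multiset (Fin 2)) = d := by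
  rw [Multiset.mem_toFinset, Multiset.mem_lists_iff, Multiset.quot_mk_to_coe, eq_comm,
    ← Multiset.toFinsupp_symm_apply, AddEquiv.eq_symm_apply]

theorem toFinsupp_cons (a : Fin 2) (v : List (Fin 2)) :
    Multiset.toFinsupp ((a :: v : List (Fin 2)) : Multiset (Fin 2))
      = Finsupp.single a 1 + Multiset.toFinsupp (v : Multiset (Fin 2)) := by
  rw [← Multiset.cons_coe, ← Multiset.singleton_add, map_add, Multiset.toFinsupp_singleton]

theorem degree_toFinsupp (w : List (Fin 2)) :
    (Multiset.toFinsupp (w : Multiset (Fin 2))).degree = w.length := by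
  induction w with
  | nil => simp
  | cons a v ih => rw [toFinsupp_cons, map_add, ih, Finsupp.degree_single, List.length_cons, add_comm]

theorem coeff_abelianize (F : NCSeries) (d : Fin 2 →₀ ℕ) :
    coeff d (abelianize F) = ∑ w ∈ (Finsupp.toMultiset d).lists.toFinset, F w := rfl

theorem coeff_X_mul_eq_ite (a : Fin 2) (f : MvPowerSeries (Fin 2) ℂ) (d : Fin 2 →₀ ℕ) :
    coeff d (X a * f) = if Finsupp.single a 1 ≤ d then coeff (d - Finsupp.single a 1) f else 0 := by
  rw [MvPowerSeries.X, coeff_monomial_mul]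
  simp

/-- Splitting a series according to the first letters of its words. -/
theorem abelianize_eq (F : NCSeries) :
    abelianize F = MvPowerSeries.C (F []) + ∑ a : Fin 2, X a * abelianize (shift [a] F) := by
  ext d
  rw [map_add, map_sum, coeff_abelianize]
  refine (sum_fiberwise _ List.head? (fun w => F w)).symm.trans ?_
  rw [Fintype.sum_option]
  congr 1
  · rw [coeff_C]
    have h (w : List (Fin 2)) : (w ∈ (Finsupp.toMultiset d).lists.toFinset ∧ w.head? = none)
        ↔ (w = [] ∧ d = 0) := by
      rw [mem_lists_toMultiset, List.head?_eq_none_iff]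
      constructor
      · rintro ⟨h, rfl⟩
        exact ⟨rfl, h.symm.trans (by simp)⟩
      · rintro ⟨rfl, rfl⟩
        simp
    split_ifs with hd
    · refine sum_eq_single_of_mem (f := fun w => F w) [] (mem_filter.mpr ((h _).mpr ⟨rfl, hd⟩)) ?_
      intro w hw hw'
      exact absurd ((h w).mp (mem_filter.mp hw)).1 hw'
    · refine sum_eq_zero fun w hw => ?_
      exact absurd ((h w).mp (mem_filter.mp hw)).2 hd
  · refine sum_congr rfl fun a _ => ?_
    rw [coeff_X_mul_eq_ite]
    have h (w : List (Fin 2)) (hw : w.head? = some a) : w = a :: w.tail := by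
      cases w with
      | nil => simp at hw
      | cons b v => simp at hw; simp [hw]
    split_ifs with hd
    · rw [coeff_abelianize]
      refine sum_nbij' List.tail (List.cons a) ?_ ?_ ?_ ?_ ?_
      · intro w hw
        rw [mem_filter, mem_lists_toMultiset] at hw
        rw [mem_lists_toMultiset, ← hw.1]
        conv_rhs => rw [h w hw.2, toFinsupp_cons, add_tsub_cancel_left]
      · intro v hv
        rw [mem_lists_toMultiset] at hv
        rw [mem_filter, mem_lists_toMultiset, toFinsupp_cons, hv, add_tsub_cancel_of_le hd]
        exact ⟨rfl, rfl⟩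
      · intro w hw
        exact (h w (mem_filter.mp hw).2).symm
      · intro v _
        rfl
      · intro w hw
        change F w = F (a :: w.tail)
        rw [← h w (mem_filter.mp hw).2]
    · refine sum_eq_zero fun w hw => absurd ?_ hd
      rw [mem_filter, mem_lists_toMultiset] at hw
      rw [← hw.1, h w hw.2, toFinsupp_cons]
      exact le_self_add

theorem abelianize_add (F G : NCSeries) : abelianize (F + G) = abelianize F + abelianize G := by
  ext d
  exact sum_add_distrib

theorem abelianize_smul (c : ℂ) (F : NCSeries) : abelianize (c • F) = c • abelianize F := by
  ext d
  exact (mul_sum _ _ _).symm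

/-- Abelianization as a linear map. -/
def abelianizeLinear : NCSeries →ₗ[ℂ] MvPowerSeries (Fin 2) ℂ where
  toFun := abelianize
  map_add' := abelianize_add
  map_smul' := abelianize_smul

theorem abelianizeLinear_apply (F : NCSeries) : abelianizeLinear F = abelianize F := rfl

/-- Each application of the recursion raises the order by one. Identities on abelianizations are
proved by checking that their defect satisfies it. -/
theorem eq_zero_of_eq_sum_X_mul_shift (Δ : NCSeries → MvPowerSeries (Fin 2) ℂ)
    (h : ∀ F, Δ F = ∑ a : Fin 2, X a * Δ (shift [a] F)) (F : NCSeries) : Δ F = 0 := by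
  suffices H : ∀ n : ℕ, ∀ (F : NCSeries) (d : Fin 2 →₀ ℕ), d.degree = n → coeff d (Δ F) = 0 by
    ext d
    exact H _ F d rfl
  intro n
  induction n using Nat.strong_induction_on with
  | _ n ih =>
    intro F d hd
    rw [h, map_sum]
    refine sum_eq_zero fun a _ => ?_
    rw [coeff_X_mul_eq_ite]
    split_ifs with ha
    · refine ih (d - Finsupp.single a 1).degree ?_ _ _ rfl
      have h1 := congrArg Finsupp.degree (add_tsub_cancel_of_le ha)
      rw [map_add, Finsupp.degree_single] at h1
      omega
    · rfl

theorem abelianize_mul (F G : NCSeries) : abelianize (F * G) = abelianize F * abelianize G := by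
  rw [← sub_eq_zero]
  refine eq_zero_of_eq_sum_X_mul_shift (fun F => abelianize (F * G) - abelianize F * abelianize G)
    (fun F => ?_) F
  rw [abelianize_eq (F * G), abelianize_eq F]
  simp only [shift_mul, abelianize_add, abelianize_smul, mul_nil, Fin.sum_univ_two, map_mul]
  conv_lhs => rw [add_mul, abelianize_eq G]
  simp only [Fin.sum_univ_two, MvPowerSeries.smul_eq_C_mul]
  rw [abelianize_eq G, Fin.sum_univ_two]
  ring

theorem abelianize_contDer (u : Fin 2 → NCSeries) (hu : ∀ l, abelianize (u l) = 0) (F : NCSeries) :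
    abelianize (contDer u F) = 0 := by
  refine eq_zero_of_eq_sum_X_mul_shift (fun F => abelianize (contDer u F)) (fun F => ?_) F
  -- `G` collects the terms in which the first letter is replaced. It abelianizes to zero, and the
  -- remaining terms keep their first letter.
  let G : NCSeries := ∑ l : Fin 2, u l * shift [l] F
  have hG : abelianize G = 0 := by
    simp only [G, Fin.sum_univ_two, abelianize_add, abelianize_mul, hu, zero_mul, add_zero]
  have h0 : contDer u F [] = G [] := by
    rw [contDer_nil, Fin.sum_univ_two]
    simp only [G, Fin.sum_univ_two, add_apply]
  have hs (a : Fin 2) : shift [a] (contDer u F) = shift [a] G + contDer u (shift [a] F) := by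
    ext v
    have := contDer_cons u F a v
    rw [Fin.sum_univ_two] at this
    simp only [G, Fin.sum_univ_two]
    exact this
  rw [abelianize_eq, h0]
  simp only [hs, abelianize_add, mul_add, sum_add_distrib]
  rw [← add_assoc, ← abelianize_eq, hG, zero_add]

/-- The series `J` of all words equals each of its shifts, so splitting off the first letter gives
Pascal's rule. -/
theorem card_lists_toMultiset (d : Fin 2 →₀ ℕ) :
    (((Finsupp.toMultiset d).lists.toFinset.card : ℕ) : ℂ) = (d 0 + d 1).choose (d 0) := by
  let J : NCSeries := fun _ => 1
  have hJ (a : Fin 2) : shift [a] J = J := rfl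
  have hcard (d : Fin 2 →₀ ℕ) :
      (((Finsupp.toMultiset d).lists.toFinset.card : ℕ) : ℂ) = coeff d (abelianize J) := by
    rw [coeff_abelianize]
    simp [J]
  rw [hcard]
  suffices H : ∀ n : ℕ, ∀ d : Fin 2 →₀ ℕ, d.degree = n →
      coeff d (abelianize J) = (d 0 + d 1).choose (d 0) from H _ d rfl
  intro n
  induction n with
  | zero =>
    intro d hd
    rw [Finsupp.degree_eq_zero_iff] at hd
    rw [abelianize_eq, hd]
    simp [J]
  | succ n ih =>
    intro d hd
    have hd0 : d ≠ 0 := by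
      rintro rfl
      simp at hd
    have hle (a : Fin 2) : Finsupp.single a 1 ≤ d ↔ 1 ≤ d a := by
      rw [Finsupp.single_le_iff]
    have hdeg (a : Fin 2) (ha : Finsupp.single a 1 ≤ d) :
        (d - Finsupp.single a 1).degree = n := by
      have h1 := congrArg Finsupp.degree (add_tsub_cancel_of_le ha)
      rw [map_add, Finsupp.degree_single] at h1
      omega
    have h0 : coeff d (X 0 * abelianize J)
        = if 1 ≤ d 0 then (((d 0 - 1 + d 1).choose (d 0 - 1) : ℕ) : ℂ) else 0 := by
      rw [coeff_X_mul_eq_ite]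
      by_cases h : 1 ≤ d 0
      · rw [if_pos ((hle 0).mpr h), if_pos h, ih _ (hdeg 0 ((hle 0).mpr h))]
        simp
      · rw [if_neg (mt (hle 0).mp h), if_neg h]
    have h1 : coeff d (X 1 * abelianize J)
        = if 1 ≤ d 1 then (((d 0 + (d 1 - 1)).choose (d 0) : ℕ) : ℂ) else 0 := by
      rw [coeff_X_mul_eq_ite]
      by_cases h : 1 ≤ d 1
      · rw [if_pos ((hle 1).mpr h), if_pos h, ih _ (hdeg 1 ((hle 1).mpr h))]
        simp
      · rw [if_neg (mt (hle 1).mp h), if_neg h]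
    have hsum : d 0 + d 1 = n + 1 := by
      rw [← hd, Finsupp.degree_eq_sum, Fin.sum_univ_two]
    rw [abelianize_eq, map_add, coeff_C, if_neg hd0, zero_add, Fin.sum_univ_two, map_add, hJ, hJ,
      h0, h1]
    generalize d 0 = i at *
    generalize d 1 = j at *
    rcases i with _ | i <;> rcases j with _ | j
    · omega
    · simp
    · simp
    · simp only [le_add_iff_nonneg_left, zero_le, if_true, Nat.add_sub_cancel]
      rw [show i + 1 + (j + 1) = (i + j + 1) + 1 by ring, Nat.choose_succ_succ,
        show i + (j + 1) = i + j + 1 by ring, show i + 1 + j = i + j + 1 by ring]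
      push_cast
      ring

theorem abelianize_symD (f : MvPowerSeries (Fin 2) ℂ) : abelianize (symD f) = binomTwist f := by
  ext d
  rw [coeff_abelianize, sum_congr rfl (g := fun _ => coeff d f), sum_const, nsmul_eq_mul,
    card_lists_toMultiset]
  · rfl
  · intro w hw
    rw [symD, (mem_lists_toMultiset d w).mp hw]

theorem abelianize_symDelta (f : MvPowerSeries (Fin 2) ℂ) (F : NCSeries) :
    abelianize (symDelta f F) = 0 := by
  refine abelianize_contDer _ (fun l => ?_) F
  rw [← abelianizeLinear_apply]
  revert l
  rw [Fin.forall_fin_two]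
  constructor
  · rw [Matrix.cons_val_zero, map_sub, abelianizeLinear_apply, abelianizeLinear_apply,
      abelianize_mul, abelianize_mul, mul_comm, sub_self]
  · exact map_zero _

end Abelianization

/-! ### The flow equation and its abelianization. -/

section Flow

open MvPowerSeries NCSeries

theorem sum_ncSeries_apply {ι : Type*} (s : Finset ι) (F : ι → NCSeries) (w : List (Fin 2)) :
    (∑ k ∈ s, F k) w = ∑ k ∈ s, F k w :=
  map_sum (⟨⟨fun G : NCSeries => G w, rfl⟩, fun _ _ => rfl⟩ : NCSeries →+ ℂ) F s

/-- The operator `F ↦ δ(F) + F D` on the right-hand side of the flow equation. -/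
def flowOp (f : MvPowerSeries (Fin 2) ℂ) : NCSeries →ₗ[ℂ] NCSeries where
  toFun F := symDelta f F + F * symD f
  map_add' F G := by
    rw [symDelta, contDer_add, add_mul]
    abel
  map_smul' c F := by
    rw [symDelta, contDer_smul, NCSeries.smul_mul', RingHom.id_apply, smul_add]

theorem flowOp_apply (f : MvPowerSeries (Fin 2) ℂ) (F : NCSeries) :
    flowOp f F = symDelta f F + F * symD f := rfl

theorem symD_nil {f : MvPowerSeries (Fin 2) ℂ} (hf : f ∈ gHat) : symD f [] = 0 := by
  have := hf 0
  rw [Finsupp.single_zero] at this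
  rw [symD, ← this]
  simp

/-- Every letter is replaced by words of length at least two, so each contributing word of `F` is
shorter than `w`. -/
theorem contDer_congr {u : Fin 2 → NCSeries} (hu : ∀ l v, v.length ≤ 1 → u l v = 0)
    {F G : NCSeries} {w : List (Fin 2)} (h : ∀ v : List (Fin 2), v.length < w.length → F v = G v) :
    contDer u F w = contDer u G w := by
  unfold contDer
  refine sum_congr rfl fun l _ => sum_congr rfl fun i hi => ?_
  rw [mul_apply, mul_apply]
  refine sum_congr rfl fun j hj => ?_
  rw [mem_range] at hi hj
  rw [List.length_drop] at hj
  by_cases hj1 : j ≤ 1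
  · rw [hu l _ ((List.length_take_le _ _).trans hj1), zero_mul, zero_mul]
  · rw [shift, shift, h]
    simp only [List.length_append, List.length_take, List.length_drop, List.length_singleton]
    omega

/-- The coefficient of `flowOp f F` at `w` depends only on the coefficients of `F` at shorter
words. -/
theorem flowOp_congr {f : MvPowerSeries (Fin 2) ℂ} (hf : f ∈ gHat) {F G : NCSeries}
    {w : List (Fin 2)} (h : ∀ v : List (Fin 2), v.length < w.length → F v = G v) :
    flowOp f F w = flowOp f G w := by
  have hX : NCSeries.X [] = 0 := by
    simp [NCSeries.X, word]
  have hu (l : Fin 2) (v : List (Fin 2)) (hv : v.length ≤ 1) :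
      (![symD f * NCSeries.X - NCSeries.X * symD f, 0] : Fin 2 → NCSeries) l v = 0 := by
    revert l
    rw [Fin.forall_fin_two]
    refine ⟨?_, rfl⟩
    rw [Matrix.cons_val_zero, NCSeries.sub_apply]
    -- Since `D` and `X` have no constant term, the commutator `[D, X]` starts in length two.
    rcases v with _ | ⟨a, _ | ⟨b, v⟩⟩
    · simp [mul_nil, hX]
    · simp [mul_cons, mul_nil, hX, symD_nil hf, shift]
    · simp at hv
  rw [flowOp_apply, flowOp_apply, NCSeries.add_apply, NCSeries.add_apply, symDelta,
    contDer_congr hu h, mul_apply, mul_apply]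
  congr 1
  refine sum_congr rfl fun i hi => ?_
  rw [mem_range] at hi
  by_cases hi' : i = w.length
  · rw [hi', List.drop_length, symD_nil hf, mul_zero, mul_zero]
  · rw [h]
    rw [List.length_take]
    omega

theorem flowOp_pow_one_apply {f : MvPowerSeries (Fin 2) ℂ} (hf : f ∈ gHat) (k : ℕ)
    (w : List (Fin 2)) (hw : w.length < k) : (flowOp f ^ k) 1 w = 0 := by
  induction k generalizing w with
  | zero => omega
  | succ k ih =>
    rw [pow_succ', Module.End.mul_apply, flowOp_congr hf (G := 0), map_zero, zero_apply]
    intro v hv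
    exact ih v (by omega)

/-- The solution of the flow equation; the coefficient at a word is polynomial in time. -/
def symFlow (f : MvPowerSeries (Fin 2) ℂ) (τ : ℂ) : NCSeries :=
  fun w => ∑ k ∈ range (w.length + 1), τ ^ k / (k.factorial : ℂ) * (flowOp f ^ k) 1 w

/-- A common truncation for all words shorter than `n`, a finite sum through which the linear
operator `flowOp f` can pass. -/
theorem symFlow_apply_of_lt {f : MvPowerSeries (Fin 2) ℂ} (hf : f ∈ gHat) (τ : ℂ)
    {w : List (Fin 2)} {n : ℕ} (hn : w.length < n) :
    symFlow f τ w = (∑ k ∈ range n, (τ ^ k / (k.factorial : ℂ)) • (flowOp f ^ k) 1) w := by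
  rw [sum_ncSeries_apply]
  refine sum_subset (range_subset_range.mpr hn) fun k _ hk => ?_
  rw [mem_range, not_lt] at hk
  rw [flowOp_pow_one_apply hf k w (by omega), mul_zero]

theorem isSymFlow_symFlow {f : MvPowerSeries (Fin 2) ℂ} (hf : f ∈ gHat) :
    IsSymFlow f (symFlow f) := by
  constructor
  · ext w
    rw [symFlow, sum_range_succ', sum_eq_zero]
    · simp
    · intro k _
      simp
  · intro τ w
    change HasDerivAt _ (flowOp f (symFlow f τ) w) τ
    rw [flowOp_congr hf fun v hv => symFlow_apply_of_lt hf τ hv, map_sum]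
    have hs : (∑ k ∈ range w.length, flowOp f ((τ ^ k / (k.factorial : ℂ)) • (flowOp f ^ k) 1)
        : NCSeries) w
        = ∑ k ∈ range w.length, τ ^ k / (k.factorial : ℂ) * (flowOp f ^ (k + 1)) 1 w := by
      simp only [map_smul, pow_succ', Module.End.mul_apply]
      exact sum_ncSeries_apply _ _ _
    rw [hs]
    simp only [symFlow, sum_range_succ' _ w.length]
    -- The added zero is the derivative of the constant term `k = 0`.
    rw [← add_zero (∑ k ∈ range w.length, _)]
    refine HasDerivAt.add (HasDerivAt.fun_sum fun k _ => ?_) ?_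
    · refine HasDerivAt.mul_const ?_ _
      have h := (hasDerivAt_pow (k + 1) τ).div_const (((k + 1).factorial : ℕ) : ℂ)
      convert h using 1
      rw [Nat.factorial_succ]
      have h1 : ((k + 1 : ℕ) : ℂ) ≠ 0 := Nat.cast_ne_zero.mpr (Nat.succ_ne_zero k)
      have h2 : ((k.factorial : ℕ) : ℂ) ≠ 0 := Nat.cast_ne_zero.mpr (Nat.factorial_ne_zero k)
      push_cast at h1 ⊢
      field_simp
    · simpa using hasDerivAt_const τ _

theorem IsSymFlow.unique {f : MvPowerSeries (Fin 2) ℂ} (hf : f ∈ gHat) {R R' : ℂ → NCSeries}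
    (hR : IsSymFlow f R) (hR' : IsSymFlow f R') : R' = R := by
  suffices H : ∀ n : ℕ, ∀ w : List (Fin 2), w.length = n → ∀ τ, R' τ w = R τ w by
    funext τ
    ext w
    exact H _ w rfl τ
  intro n
  induction n using Nat.strong_induction_on with
  | _ n ih =>
    intro w hw τ
    have hd (s : ℂ) : HasDerivAt (fun s => R' s w - R s w) 0 s := by
      have h := (hR'.2 s w).sub (hR.2 s w)
      -- The right-hand side at `w` sees only shorter words, where the solutions agree by induction.
      -- The difference at `w` is therefore constant in time, and it vanishes at time zero.
      have hop : flowOp f (R' s) w = flowOp f (R s) w :=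
        flowOp_congr hf fun v hv => ih v.length (by omega) v rfl s
      rw [flowOp_apply, flowOp_apply, ← sub_eq_zero] at hop
      rwa [hop] at h
    have h := is_const_of_deriv_eq_zero (fun s => (hd s).differentiableAt)
      (fun s => (hd s).deriv) τ 0
    rwa [hR.1, hR'.1, sub_self, sub_eq_zero] at h

theorem abelianize_flowOp_pow_one (f : MvPowerSeries (Fin 2) ℂ) (k : ℕ) :
    abelianize ((flowOp f ^ k) 1) = binomTwist f ^ k := by
  induction k with
  | zero =>
    have h (a : Fin 2) : shift [a] (1 : NCSeries) = 0 := by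
      ext v
      simp [shift, one_apply]
    rw [pow_zero, pow_zero, Module.End.one_apply, abelianize_eq, Fin.sum_univ_two, h, h,
      ← abelianizeLinear_apply, map_zero]
    simp [one_apply]
  | succ k ih =>
    rw [pow_succ', Module.End.mul_apply, flowOp_apply, abelianize_add, abelianize_symDelta,
      abelianize_mul, ih, abelianize_symD, zero_add, pow_succ]

theorem abelianize_symFlow_one {f : MvPowerSeries (Fin 2) ℂ} (hf : f ∈ gHat) :
    abelianize (symFlow f 1) = mvExp (binomTwist f) := by
  have hf0 : constantCoeff f = 0 := by
    have := hf 0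
    rwa [Finsupp.single_zero] at this
  ext d
  rw [mvExp, coeff_subst_eq_sum_range _ (constantCoeff_binomTwist hf0) (Nat.lt_succ_self d.degree),
    coeff_abelianize]
  -- Words over `d` all have length `d.degree`, so the truncation of the flow matches that of the
  -- exponential, and the sums agree for each `k`.
  have hw : ∀ w ∈ (Finsupp.toMultiset d).lists.toFinset, symFlow f 1 w
      = ∑ k ∈ range (d.degree + 1), (1 / (k.factorial : ℂ)) * (flowOp f ^ k) 1 w := by
    intro w hw
    rw [mem_lists_toMultiset] at hw
    rw [← hw, degree_toFinsupp]
    simp [symFlow]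
  rw [sum_congr rfl hw, sum_comm]
  refine sum_congr rfl fun k _ => ?_
  refine (mul_sum _ (fun w => (flowOp f ^ k) 1 w) _).symm.trans ?_
  rw [← abelianize_flowOp_pow_one, PowerSeries.coeff_exp, coeff_abelianize]
  simp

end Flow

end NCInt

end

theorem theorem2 :
    (∀ P : MvPolynomial (Fin 2) ℂ, MvPolynomial.constantCoeff P = 1 →
      NCInt.IsAlgebraicSeries
        (NCInt.mvExp (NCInt.binomTwist (NCInt.mvLog (P : MvPowerSeries (Fin 2) ℂ))))) ∧
    (∀ f : MvPowerSeries (Fin 2) ℂ, f ∈ NCInt.gHat → NCInt.IsLogOfRational f →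
      ∃ R : ℂ → NCInt.NCSeries, NCInt.IsSymFlow f R ∧
        (∀ R' : ℂ → NCInt.NCSeries, NCInt.IsSymFlow f R' → R' = R) ∧
        NCInt.IsAlgebraicSeries (NCInt.NCSeries.abelianize (R 1))) := by
  refine ⟨NCInt.isAlgebraicSeries_mvExp_binomTwist_mvLog, fun f hf hrat => ?_⟩
  obtain ⟨φ, hφ, hφ1, rfl⟩ := hrat
  refine ⟨NCInt.symFlow _, NCInt.isSymFlow_symFlow hf,
    fun R' hR' => NCInt.IsSymFlow.unique hf (NCInt.isSymFlow_symFlow hf) hR', ?_⟩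
  rw [NCInt.abelianize_symFlow_one hf]
  exact NCInt.isAlgebraicSeries_mvExp_binomTwist_mvLog_of_isRationalSeries hφ hφ1
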